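/- **Conventions.** Let $N=\mathbb Z^n$ and $N_{\mathbb R}=\mathbb R^n$. A cone is a strongly convex rational polyhedral cone in $N_{\mathbb R}$; a fan is a finite collection of cones closed under taking faces and such that any two cones meet in a common face; it is complete if its cones cover $N_{\mathbb R}$, and smooth if each of its cones is generated by part of a $\mathbb Z$-basis of $N$. For fans $\Gamma,\Sigma$ write $\Gamma\preceq\Sigma$ if every cone of $\Gamma$ is contained in a cone of $\Sigma$. A support function of a complete fan $\Phi$ is a function $h\colon N_{\mathbb R}\to\mathbb R$ whose restriction to each maximal cone is linear. It is strictly upper convex if it is concave and, for every maximal cone $\sigma\in\Phi$ with $h|_\sigma=m_\sigma|_\sigma$, $m_\sigma$ a linear form, one has $h(x)=m_\sigma(x)$ only for $x\in\sigma$. A complete fan is projective if it admits a strictly upper convex support function. Let $\Gamma$ be a smooth complete fan and let $\tau=\langle r_1,\dots,r_{n-1}\rangle$ be a wall of $\Gamma$, shared by the two distinct maximal cones $\langle\tau,a\rangle$ and $\langle\tau,b\rangle$ (all generators primitive), with wall relation $a+b=\sum_i c_ir_i$, $c_i\in\mathbb Z$. The bend of a support function $g$ of $\Gamma$ across $\tau$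 is $\delta_\tau(g)=\sum_i c_i\,g(r_i)-g(a)-g(b)$. Let $\Sigma$ be a complete fan with $\Gamma\preceq\Sigma$. The function $g$ is strictly convex relative to $\Sigma$ if $\delta_\tau(g)>0$ for every wall $\tau$ of $\Gamma$ whose relative interior lies in the interior of a maximal cone of $\Sigma$. The refinement morphism of toric varieties $X_\Gamma\to X_\Sigma$ is called projective if a support function of $\Gamma$ that is strictly convex relative to $\Sigma$ exists. **Lemma 6.4 (Sandwich projectivity).** Let $\Sigma$ be a complete fan, let $\mathcal A$ be a complete projective fan with $\mathcal A\preceq\Sigma$, and let $\Gamma$ be a smooth complete fan with $\Gamma\preceq\mathcal A$ such that $X_\Gamma\to X_\Sigma$ is projective. Then $\Gamma$ is projective, and it even has a strictly upper convex support function that takes integer values on $N$. Explicitly, for every strictly upper convex support function $h$ of $\mathcal A$ and every support function $g$ of $\Gamma$ that is strictly convex relative to $\Sigma$, there is $\varepsilon_0>0$ such that $h+\varepsilon g$ is a strictly upper convex support function of $\Gamma$ for all real (in particular all rational) $\varepsilon$ with $0<\varepsilon<\varepsilon_0$. -/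

import Mathlib

/-- The standard inclusion of the lattice `N = ℤⁿ` into `N_ℝ = ℝⁿ`. -/
def latticeVec {n : ℕ} (v : Fin n → ℤ) : Fin n → ℝ := fun i => (v i : ℝ)

/-- The cone in `N_ℝ` generated by a set of lattice vectors. -/
def latticeCone {n : ℕ} (s : Set (Fin n → ℤ)) : PointedCone ℝ (Fin n → ℝ) :=
  PointedCone.hull ℝ (latticeVec '' s)

/-- A strongly convex rational polyhedral cone: generated by finitely many lattice vectors and
containing no line. -/
def IsRationalCone {n : ℕ} (σ : PointedCone ℝ (Fin n → ℝ)) : Prop :=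
  (∃ s : Set (Fin n → ℤ), s.Finite ∧ σ = latticeCone s) ∧ ∀ x ∈ σ, -x ∈ σ → x = 0

/-- The dimension of a cone is the dimension of its linear span. -/
noncomputable def coneDim {n : ℕ} (σ : PointedCone ℝ (Fin n → ℝ)) : ℕ :=
  Module.finrank ℝ (Submodule.span ℝ (σ : Set (Fin n → ℝ)))

/-- The family `v` is a `ℤ`-basis of the lattice `N = ℤⁿ`. -/
def IsLatticeBasis {n : ℕ} {ι : Type} (v : ι → (Fin n → ℤ)) : Prop :=
  LinearIndependent ℤ v ∧ Submodule.span ℤ (Set.range v) = ⊤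

/-- A cone is smooth if it is generated by a part of a lattice basis. -/
def IsSmoothCone {n : ℕ} (σ : PointedCone ℝ (Fin n → ℝ)) : Prop :=
  ∃ (v : Fin n → (Fin n → ℤ)) (s : Set (Fin n)), IsLatticeBasis v ∧ σ = latticeCone (v '' s)

/-- A (finite) fan in `N_ℝ = ℝⁿ`. -/
structure Fan (n : ℕ) where
  cones : Set (PointedCone ℝ (Fin n → ℝ))
  finite_cones : cones.Finite
  isRationalCone : ∀ σ ∈ cones, IsRationalCone σ
  face_mem : ∀ σ ∈ cones, ∀ τ : PointedCone ℝ (Fin n → ℝ), τ.IsFaceOf σ → τ ∈ cones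
  inter_isFaceOf : ∀ σ ∈ cones, ∀ τ ∈ cones, (σ ⊓ τ).IsFaceOf σ ∧ (σ ⊓ τ).IsFaceOf τ

namespace Fan

/-- The support of the fan is all of `N_ℝ`. -/
def IsComplete {n : ℕ} (Φ : Fan n) : Prop :=
  ∀ x : Fin n → ℝ, ∃ σ ∈ Φ.cones, x ∈ σ

/-- Every cone of the fan is smooth. -/
def IsSmooth {n : ℕ} (Φ : Fan n) : Prop :=
  ∀ σ ∈ Φ.cones, IsSmoothCone σ

/-- `Γ ⪯ Φ`: every cone of `Γ` is contained in a cone of `Φ`. -/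
def Refines {n : ℕ} (Γ Φ : Fan n) : Prop :=
  ∀ γ ∈ Γ.cones, ∃ σ ∈ Φ.cones, γ ≤ σ

/-- The `n`-dimensional cones; for a complete fan these are exactly the maximal cones. -/
def maxCones {n : ℕ} (Φ : Fan n) : Set (PointedCone ℝ (Fin n → ℝ)) :=
  {σ | σ ∈ Φ.cones ∧ coneDim σ = n}

/-- A `Φ`-linear support function: a real function on `N_ℝ` that is linear on each maximal cone. -/
def IsSupportFunction {n : ℕ} (Φ : Fan n) (h : (Fin n → ℝ) → ℝ) : Prop :=
  ∀ σ ∈ Φ.maxCones, ∃ m : (Fin n → ℝ) →ₗ[ℝ] ℝ, ∀ x ∈ σ, h x = m x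

/-- A strictly upper convex support function: it is upper convex (that is, concave), and the linear
form `m` that represents it on a maximal cone `σ` agrees with it exactly on `σ`. -/
def IsStrictlyUpperConvex {n : ℕ} (Φ : Fan n) (h : (Fin n → ℝ) → ℝ) : Prop :=
  Φ.IsSupportFunction h ∧ ConcaveOn ℝ Set.univ h ∧
    ∀ σ ∈ Φ.maxCones, ∀ m : (Fin n → ℝ) →ₗ[ℝ] ℝ, (∀ x ∈ σ, h x = m x) →
      ∀ x, h x = m x → x ∈ σ

/-- A (complete) fan is projective if it has a strictly upper convex support function. -/
def IsProjective {n : ℕ} (Φ : Fan n) : Prop :=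
  ∃ h : (Fin n → ℝ) → ℝ, Φ.IsStrictlyUpperConvex h

/-- A wall of a smooth fan together with its wall relation. The wall is `τ = ⟨r₁, …, rₖ⟩`, and it is
shared by the two distinct maximal cones `σ₊ = ⟨τ, a⟩` and `σ₋ = ⟨τ, b⟩`, whose generators form
lattice bases (so `k = n - 1`); the wall relation is `a + b = ∑ cᵢ rᵢ`. For a smooth complete fan
every `(n-1)`-dimensional cone arises in this way, uniquely up to the order of the `rᵢ` and the
exchange of `a` and `b`. -/
structure WallRelation {n : ℕ} (Φ : Fan n) where
  k : ℕ
  r : Fin k → (Fin n → ℤ)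
  a : Fin n → ℤ
  b : Fin n → ℤ
  c : Fin k → ℤ
  basis_a : IsLatticeBasis (Fin.cons a r : Fin (k + 1) → (Fin n → ℤ))
  basis_b : IsLatticeBasis (Fin.cons b r : Fin (k + 1) → (Fin n → ℤ))
  cone_a_mem : latticeCone (insert a (Set.range r)) ∈ Φ.cones
  cone_b_mem : latticeCone (insert b (Set.range r)) ∈ Φ.cones
  ne : a ≠ b
  relation : a + b = ∑ i, c i • r i

namespace WallRelation

/-- The wall `τ = ⟨r₁, …, rₖ⟩`. -/
def wall {n : ℕ} {Φ : Fan n} (w : Φ.WallRelation) : PointedCone ℝ (Fin n → ℝ) :=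
  latticeCone (Set.range w.r)

/-- The bend `δ_τ(h) = ∑ cᵢ h(rᵢ) - h(a) - h(b)` of `h` across the wall. -/
noncomputable def bend {n : ℕ} {Φ : Fan n} (w : Φ.WallRelation) (h : (Fin n → ℝ) → ℝ) : ℝ :=
  ∑ i, (w.c i : ℝ) * h (latticeVec (w.r i)) - h (latticeVec w.a) - h (latticeVec w.b)

end WallRelation

/-- A `Γ`-linear support function `g` (`Γ` smooth) is strictly convex relative to `Φ` if it bends
strictly across every wall of `Γ` whose relative interior lies in the interior of a maximal cone
of `Φ`. -/
def IsStrictlyConvexRelativeTo {n : ℕ} (Γ Φ : Fan n) (g : (Fin n → ℝ) → ℝ) : Prop :=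
  Γ.IsSupportFunction g ∧
    ∀ w : Γ.WallRelation,
      (∃ σ ∈ Φ.maxCones, intrinsicInterior ℝ (w.wall : Set (Fin n → ℝ)) ⊆
        interior (σ : Set (Fin n → ℝ))) → 0 < w.bend g

/-- The refinement morphism `X_Γ → X_Φ` (`Γ` smooth and complete, refining the complete fan `Φ`) is
projective: there is a `Γ`-linear support function that is strictly convex relative to `Φ`. -/
def IsProjectiveOver {n : ℕ} (Γ Φ : Fan n) : Prop :=
  ∃ g : (Fin n → ℝ) → ℝ, Γ.IsStrictlyConvexRelativeTo Φ g

end Fan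

/-! Strict upper convexity on a smooth complete fan is a local condition: positive bend across every
wall suffices (`Fan.isStrictlyUpperConvex_of_bend_pos`). The bend is linear in the function, so the
walls of `Γ` can be treated one at a time. If both maximal cones at a wall lie in one maximal cone
of `A`, then `h` is linear there and has bend zero; the wall is then interior to that cone, hence to
a maximal cone of `S`, and `g` bends positively. At any other wall the strictness of `h` makes its
bend positive (`Fan.IsStrictlyUpperConvex.bend_pos_or`), and a small multiple of `g` cannot spoil
this, whatever its sign. As there are finitely many walls (`Fan.finite_wallRelation`), one `ε₀`
serves all of them.

The passage from local to global needs a neighbouring cone across every facet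
(`Fan.exists_adjacent_cone`). Crossing a facet that separates a cone from `x` lowers the value at
`x` of the representing linear form, so the smallest value comes from a cone containing `x`, and the
function is the minimum of its linear forms.

For integrality, a large multiple of the function is rounded down on the ray generators: the bend
grows with the multiple, while the rounding loss at each wall stays bounded. -/

@[simp] lemma latticeVec_add {n : ℕ} (u v : Fin n → ℤ) :
    latticeVec (u + v) = latticeVec u + latticeVec v := by
  ext i; simp [latticeVec]

@[simp] lemma latticeVec_zsmul {n : ℕ} (c : ℤ) (v : Fin n → ℤ) :
    latticeVec (c • v) = (c : ℝ) • latticeVec v := by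
  ext i; simp [latticeVec]

@[simp] lemma latticeVec_sum {n : ℕ} {ι : Type*} (s : Finset ι) (v : ι → Fin n → ℤ) :
    latticeVec (∑ i ∈ s, v i) = ∑ i ∈ s, latticeVec (v i) := by
  ext j; simp [latticeVec]

/-! ### Coordinates with respect to a lattice basis -/

namespace IsLatticeBasis

variable {n : ℕ} {ι : Type} {v : ι → Fin n → ℤ}

/-- The basis of the lattice given by a lattice basis. -/
noncomputable def intBasis (hv : IsLatticeBasis v) : Module.Basis ι ℤ (Fin n → ℤ) :=
  Module.Basis.mk hv.1 hv.2.ge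

@[simp] lemma intBasis_apply (hv : IsLatticeBasis v) (i : ι) : hv.intBasis i = v i := by
  simp [intBasis]

lemma top_le_span_real [Fintype ι] (hv : IsLatticeBasis v) :
    ⊤ ≤ Submodule.span ℝ (Set.range fun i => latticeVec (v i)) := by
  rw [← (Pi.basisFun ℝ (Fin n)).span_eq, Submodule.span_le]
  rintro _ ⟨j, rfl⟩
  have h : Pi.basisFun ℝ (Fin n) j = latticeVec (Pi.single j 1) := by
    ext i
    simp [latticeVec, Pi.single_apply]
  rw [h, ← hv.intBasis.sum_repr (Pi.single j 1)]
  simp only [latticeVec_sum, latticeVec_zsmul, intBasis_apply]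
  exact Submodule.sum_mem _ fun i _ => Submodule.smul_mem _ _ (Submodule.subset_span ⟨i, rfl⟩)

lemma card_eq [Fintype ι] (hv : IsLatticeBasis v) : Fintype.card ι = n := by
  simpa using Fintype.card_congr (hv.intBasis.indexEquiv (Pi.basisFun ℤ (Fin n)))

/-- A lattice basis is a basis of the real vector space. -/
noncomputable def realBasis [Fintype ι] (hv : IsLatticeBasis v) :
    Module.Basis ι ℝ (Fin n → ℝ) :=
  basisOfTopLeSpanOfCardEqFinrank (fun i => latticeVec (v i)) hv.top_le_span_real
    (by simp [hv.card_eq])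

variable [Fintype ι]

@[simp] lemma realBasis_apply (hv : IsLatticeBasis v) (i : ι) :
    hv.realBasis i = latticeVec (v i) := by
  simp [realBasis]

lemma sum_repr (hv : IsLatticeBasis v) (x : Fin n → ℝ) :
    ∑ i, hv.realBasis.repr x i • latticeVec (v i) = x := by
  simpa using hv.realBasis.sum_repr x

lemma map_eq_sum (hv : IsLatticeBasis v) (m : (Fin n → ℝ) →ₗ[ℝ] ℝ) (x : Fin n → ℝ) :
    m x = ∑ i, hv.realBasis.repr x i * m (latticeVec (v i)) := by
  conv_lhs => rw [← hv.sum_repr x]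
  simp

lemma repr_self [DecidableEq ι] (hv : IsLatticeBasis v) (i j : ι) :
    hv.realBasis.repr (latticeVec (v i)) j = if i = j then 1 else 0 := by
  rw [← hv.realBasis_apply, Module.Basis.repr_self, Finsupp.single_apply]

lemma repr_latticeVec (hv : IsLatticeBasis v) (u : Fin n → ℤ) (i : ι) :
    hv.realBasis.repr (latticeVec u) i = hv.intBasis.repr u i := by
  classical
  conv_lhs => rw [← hv.intBasis.sum_repr u]
  simp only [latticeVec_sum, latticeVec_zsmul, intBasis_apply, map_sum, map_smul,
    Finsupp.finsetSum_apply, Finsupp.smul_apply, repr_self]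
  simp

/-- Turns cone membership into sign conditions on coordinates, the form in which smooth cones are
used throughout. -/
lemma mem_latticeCone_image (hv : IsLatticeBasis v) (s : Set ι) (x : Fin n → ℝ) :
    x ∈ latticeCone (v '' s) ↔
      ∀ i, 0 ≤ hv.realBasis.repr x i ∧ (i ∉ s → hv.realBasis.repr x i = 0) := by
  classical
  constructor
  · intro hx
    induction hx using Submodule.span_induction with
    | mem x hx =>
      obtain ⟨_, ⟨j, hj, rfl⟩, rfl⟩ := hx
      intro i
      rw [repr_self]
      split_ifs with h
      · subst h; simp [hj]
      · simp
    | zero => simp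
    | add x y _ _ hx hy =>
      intro i
      simp only [map_add, Finsupp.add_apply]
      exact ⟨add_nonneg (hx i).1 (hy i).1, fun h => by rw [(hx i).2 h, (hy i).2 h, add_zero]⟩
    | smul c x _ hx =>
      intro i
      have : hv.realBasis.repr (c • x) i = (c : ℝ) * hv.realBasis.repr x i := by
        rw [show c • x = (c : ℝ) • x from rfl, map_smul]; rfl
      rw [this]
      exact ⟨mul_nonneg c.2 (hx i).1, fun h => by rw [(hx i).2 h, mul_zero]⟩
  · intro h
    rw [← hv.sum_repr x]
    refine Submodule.sum_mem _ fun i _ => ?_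
    by_cases hi : i ∈ s
    · exact PointedCone.smul_mem _ (h i).1
        (PointedCone.subset_hull (Set.mem_image_of_mem _ (Set.mem_image_of_mem _ hi)))
    · rw [(h i).2 hi, zero_smul]
      exact Submodule.zero_mem _

lemma mem_latticeCone_range (hv : IsLatticeBasis v) (x : Fin n → ℝ) :
    x ∈ latticeCone (Set.range v) ↔ ∀ i, 0 ≤ hv.realBasis.repr x i := by
  rw [← Set.image_univ, hv.mem_latticeCone_image]
  simp

lemma coneDim_image (hv : IsLatticeBasis v) (s : Set ι) :
    coneDim (latticeCone (v '' s)) = s.ncard := by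
  classical
  have h : Submodule.span ℝ (latticeCone (v '' s) : Set (Fin n → ℝ)) =
      Submodule.span ℝ (Set.range fun i : s => hv.realBasis i) := by
    apply le_antisymm
    · rw [Submodule.span_le]
      intro x hx
      have := (hv.mem_latticeCone_image s x).1 hx
      rw [← hv.sum_repr x]
      refine Submodule.sum_mem _ fun i _ => ?_
      by_cases hi : i ∈ s
      · exact Submodule.smul_mem _ _ (Submodule.subset_span ⟨⟨i, hi⟩, by simp⟩)
      · rw [(this i).2 hi, zero_smul]
        exact Submodule.zero_mem _
    · rw [Submodule.span_le]
      rintro _ ⟨i, rfl⟩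
      refine Submodule.subset_span (PointedCone.subset_hull ?_)
      simp only [realBasis_apply]
      exact Set.mem_image_of_mem _ (Set.mem_image_of_mem _ i.2)
  have hli : LinearIndependent ℝ fun i : s => hv.realBasis i :=
    hv.realBasis.linearIndependent.comp _ Subtype.val_injective
  rw [coneDim, h, finrank_span_eq_card hli, Set.ncard_eq_toFinset_card', Set.toFinset_card]

lemma coneDim_range (hv : IsLatticeBasis v) : coneDim (latticeCone (Set.range v)) = n := by
  rw [← Set.image_univ, hv.coneDim_image, Set.ncard_univ, Nat.card_eq_fintype_card, hv.card_eq]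

end IsLatticeBasis

/-! ### Primitive generators, recovered from the cone alone -/

/-- The nonzero lattice points of a cone that are not a sum of two nonzero lattice points of the
cone. For a smooth cone these are its primitive generators. -/
def latticeIrreducibles {n : ℕ} (σ : PointedCone ℝ (Fin n → ℝ)) : Set (Fin n → ℤ) :=
  {p | latticeVec p ∈ σ ∧ p ≠ 0 ∧
    ∀ u w, latticeVec u ∈ σ → latticeVec w ∈ σ → p = u + w → u = 0 ∨ w = 0}

/-- A positive integer coordinate is at least 1, so the corresponding generator can be split off;
conversely, a coordinate 1 is not a sum of two positive integers. Hence the generators do not depend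
on the chosen basis and can be compared between cones. -/
lemma IsLatticeBasis.latticeIrreducibles_image {n : ℕ} {ι : Type} [Fintype ι]
    {v : ι → Fin n → ℤ} (hv : IsLatticeBasis v) (s : Set ι) :
    latticeIrreducibles (latticeCone (v '' s)) = v '' s := by
  classical
  have hmem : ∀ i ∈ s, latticeVec (v i) ∈ latticeCone (v '' s) := fun i hi =>
    PointedCone.subset_hull (Set.mem_image_of_mem _ (Set.mem_image_of_mem _ hi))
  have hint : ∀ u : Fin n → ℤ, latticeVec u ∈ latticeCone (v '' s) →
      ∀ i, 0 ≤ hv.intBasis.repr u i ∧ (i ∉ s → hv.intBasis.repr u i = 0) := by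
    intro u hu i
    have := (hv.mem_latticeCone_image s _).1 hu i
    rw [hv.repr_latticeVec] at this
    exact_mod_cast this
  ext p
  constructor
  · rintro ⟨hp, hp0, hirr⟩
    have hc := hint p hp
    obtain ⟨i, hi⟩ : ∃ i, hv.intBasis.repr p i ≠ 0 := by
      by_contra! h
      exact hp0 ((hv.intBasis.repr.map_eq_zero_iff).1 (Finsupp.ext h))
    have his : i ∈ s := by
      by_contra h
      exact hi ((hc i).2 h)
    have hsub : latticeVec (p - v i) ∈ latticeCone (v '' s) := by
      rw [hv.mem_latticeCone_image]
      intro j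
      rw [hv.repr_latticeVec, ← hv.intBasis_apply i]
      simp only [map_sub, Finsupp.sub_apply, Module.Basis.repr_self, Finsupp.single_apply]
      have h0 := hc j
      split_ifs with h
      · subst h
        refine ⟨?_, fun h => absurd his h⟩
        have : 1 ≤ hv.intBasis.repr p i := by have := (hc i).1; omega
        exact_mod_cast sub_nonneg.2 this
      · simpa using h0
    rcases hirr (v i) (p - v i) (hmem i his) hsub (by abel) with h | h
    · exact absurd h (hv.1.ne_zero i)
    · exact ⟨i, his, (sub_eq_zero.1 h).symm⟩
  · rintro ⟨i, hi, rfl⟩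
    refine ⟨hmem i hi, hv.1.ne_zero i, fun u w hu hw huw => ?_⟩
    have hu' := hint u hu
    have hw' := hint w hw
    have hsum : ∀ j, (if i = j then 1 else 0) = hv.intBasis.repr u j + hv.intBasis.repr w j := by
      intro j
      rw [← Finsupp.add_apply, ← map_add, ← huw, ← hv.intBasis_apply i, Module.Basis.repr_self,
        Finsupp.single_apply]
    have hi' := hsum i
    rw [if_pos rfl] at hi'
    have key : hv.intBasis.repr u i = 0 ∨ hv.intBasis.repr w i = 0 := by
      have := (hu' i).1; have := (hw' i).1; omega
    refine key.imp (fun h => ?_) (fun h => ?_)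
    all_goals
      refine (hv.intBasis.repr.map_eq_zero_iff).1 (Finsupp.ext fun j => ?_)
      by_cases hij : i = j
      · subst hij; exact h
      · have h1 := hsum j
        rw [if_neg hij] at h1
        have := (hu' j).1; have := (hw' j).1
        simp only [Finsupp.coe_zero, Pi.zero_apply]
        omega

lemma IsLatticeBasis.latticeIrreducibles_range {n : ℕ} {ι : Type} [Fintype ι]
    {v : ι → Fin n → ℤ} (hv : IsLatticeBasis v) :
    latticeIrreducibles (latticeCone (Set.range v)) = Set.range v := by
  rw [← Set.image_univ, hv.latticeIrreducibles_image]

lemma IsSmoothCone.finite_latticeIrreducibles {n : ℕ} {σ : PointedCone ℝ (Fin n → ℝ)}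
    (hσ : IsSmoothCone σ) : (latticeIrreducibles σ).Finite := by
  obtain ⟨v, s, hv, rfl⟩ := hσ
  rw [hv.latticeIrreducibles_image]
  exact s.toFinite.image _

lemma IsSmoothCone.exists_basis_of_coneDim {n : ℕ} {σ : PointedCone ℝ (Fin n → ℝ)}
    (hσ : IsSmoothCone σ) (hd : coneDim σ = n) :
    ∃ v : Fin n → Fin n → ℤ, IsLatticeBasis v ∧ σ = latticeCone (Set.range v) := by
  obtain ⟨v, s, hv, rfl⟩ := hσ
  refine ⟨v, hv, ?_⟩
  rw [hv.coneDim_image] at hd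
  have : s = Set.univ := Set.eq_of_subset_of_ncard_le (Set.subset_univ s) (by simp [hd])
  rw [this, Set.image_univ]

/-- An irreducible lattice point of a cone is irreducible in every cone that contains it and
meets the first one in a face. -/
lemma mem_latticeIrreducibles_of_mem {n : ℕ} {σ τ : PointedCone ℝ (Fin n → ℝ)}
    (h : (σ ⊓ τ).IsFaceOf τ) {p : Fin n → ℤ} (hp : p ∈ latticeIrreducibles σ)
    (hpτ : latticeVec p ∈ τ) : p ∈ latticeIrreducibles τ := by
  obtain ⟨hpσ, hp0, hirr⟩ := hp
  refine ⟨hpτ, hp0, fun u w hu hw huw => ?_⟩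
  have hmem : latticeVec u + latticeVec w ∈ σ ⊓ τ := by
    rw [← latticeVec_add, ← huw]
    exact ⟨hpσ, hpτ⟩
  obtain ⟨h1, h2⟩ := (h.add_mem_iff_mem hu hw).1 hmem
  exact hirr u w h1.1 h2.1 huw

/-- The generators of a smooth cone that occur in a point of another cone of the fan belong to
the other cone. -/
lemma IsLatticeBasis.mem_of_repr_pos {n : ℕ} {ι : Type} [Fintype ι]
    {v : ι → Fin n → ℤ} (hv : IsLatticeBasis v) {s : Set ι} {τ : PointedCone ℝ (Fin n → ℝ)}
    (h : (latticeCone (v '' s) ⊓ τ).IsFaceOf (latticeCone (v '' s))) {x : Fin n → ℝ}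
    (hx : x ∈ latticeCone (v '' s)) (hxτ : x ∈ τ) {i : ι} (hi : 0 < hv.realBasis.repr x i) :
    latticeVec (v i) ∈ τ := by
  classical
  have hc := (hv.mem_latticeCone_image s x).1 hx
  have his : i ∈ s := by
    by_contra h'
    exact hi.ne' ((hc i).2 h')
  have hvi : latticeVec (v i) ∈ latticeCone (v '' s) :=
    PointedCone.subset_hull (Set.mem_image_of_mem _ (Set.mem_image_of_mem _ his))
  refine (h.mem_of_smul_add_mem (y := x - hv.realBasis.repr x i • latticeVec (v i)) hvi ?_ hi
    ?_).2
  · rw [hv.mem_latticeCone_image]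
    intro j
    simp only [map_sub, map_smul, Finsupp.sub_apply, Finsupp.smul_apply, hv.repr_self, smul_eq_mul]
    split_ifs with hij
    · subst hij; simp
    · simpa using hc j
  · rw [add_sub_cancel]
    exact ⟨hx, hxτ⟩

lemma latticeVec_mem_latticeCone {n : ℕ} {s : Set (Fin n → ℤ)} {p : Fin n → ℤ} (hp : p ∈ s) :
    latticeVec p ∈ latticeCone s :=
  PointedCone.subset_hull (Set.mem_image_of_mem _ hp)

lemma IsLatticeBasis.comp_equiv {n : ℕ} {ι κ : Type} {v : ι → Fin n → ℤ}
    (hv : IsLatticeBasis v) (e : κ ≃ ι) : IsLatticeBasis (v ∘ e) :=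
  ⟨hv.1.comp e e.injective, by rw [e.surjective.range_comp]; exact hv.2⟩

lemma IsSmoothCone.isClosed {n : ℕ} {σ : PointedCone ℝ (Fin n → ℝ)} (hσ : IsSmoothCone σ) :
    IsClosed (σ : Set (Fin n → ℝ)) := by
  obtain ⟨v, s, hv, rfl⟩ := hσ
  have hcont : ∀ i, Continuous fun x => hv.realBasis.repr x i := fun i =>
    (hv.realBasis.coord i).continuous_of_finiteDimensional
  have h : (latticeCone (v '' s) : Set (Fin n → ℝ)) =
      {x | ∀ i, 0 ≤ hv.realBasis.repr x i ∧ (i ∉ s → hv.realBasis.repr x i = 0)} := by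
    ext x
    exact hv.mem_latticeCone_image s x
  rw [h]
  simp only [Set.ofPred_forall, Set.ofPred_and]
  exact isClosed_iInter fun i => (isClosed_le continuous_const (hcont i)).inter
    (isClosed_iInter fun _ => isClosed_eq (hcont i) continuous_const)

/-! ### Complete fans and neighbouring cones -/

namespace Fan

variable {n : ℕ}

lemma IsComplete.exists_frequently_mem {Φ : Fan n} (hΦ : Φ.IsComplete) (y : ℕ → Fin n → ℝ) :
    ∃ σ ∈ Φ.cones, ∃ᶠ t in Filter.atTop, y t ∈ σ := by
  by_contra! h
  have h' : ∀ᶠ t in Filter.atTop, ∀ σ ∈ Φ.cones, y t ∉ σ :=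
    (Filter.eventually_all_finite Φ.finite_cones).2 fun σ hσ => h σ hσ
  obtain ⟨t, ht⟩ := h'.exists
  obtain ⟨σ, hσ, hy⟩ := hΦ (y t)
  exact ht σ hσ hy

/-- A real vector space is not a finite union of proper subspaces, so some cone has full span. -/
lemma IsComplete.maxCones_nonempty {Φ : Fan n} (hΦ : Φ.IsComplete) : Φ.maxCones.Nonempty := by
  classical
  by_contra! h
  let S : Finset (Submodule ℝ (Fin n → ℝ)) :=
    Φ.finite_cones.toFinset.image
      fun σ : PointedCone ℝ (Fin n → ℝ) => Submodule.span ℝ (σ : Set (Fin n → ℝ))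
  have hS : ⊤ ∉ S := by
    intro hmem
    obtain ⟨σ, hσ, hspan⟩ := Finset.mem_image.1 hmem
    have : σ ∈ Φ.maxCones := by
      refine ⟨Φ.finite_cones.mem_toFinset.1 hσ, ?_⟩
      rw [coneDim, hspan]
      simp
    rw [h] at this
    exact this
  refine Subspace.biUnion_ne_univ_of_top_notMem hS (Set.eq_univ_of_forall fun x => ?_)
  obtain ⟨σ, hσ, hx⟩ := hΦ x
  exact Set.mem_biUnion (Finset.mem_image.2 ⟨σ, Φ.finite_cones.mem_toFinset.2 hσ, rfl⟩)
    (Submodule.subset_span hx)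

/-- Every facet of a maximal cone of a smooth complete fan is a wall. -/
lemma exists_adjacent_cone {Γ : Fan n} (hΓ : Γ.IsComplete) (hsm : Γ.IsSmooth) {k : ℕ}
    {a : Fin n → ℤ} {r : Fin k → Fin n → ℤ}
    (ha : IsLatticeBasis (Fin.cons a r : Fin (k + 1) → (Fin n → ℤ)))
    (hmem : latticeCone (insert a (Set.range r)) ∈ Γ.cones) :
    ∃ (b : Fin n → ℤ) (c : Fin k → ℤ),
      IsLatticeBasis (Fin.cons b r : Fin (k + 1) → (Fin n → ℤ)) ∧
      latticeCone (insert b (Set.range r)) ∈ Γ.cones ∧ a ≠ b ∧ a + b = ∑ i, c i • r i := by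
  classical
  have hn : k + 1 = n := by simpa using ha.card_eq
  -- A point in the relative interior of the facet; subtracting small multiples of `a` crosses to
  -- the other side.
  set z : Fin n → ℝ := ∑ j, latticeVec (r j) with hz
  have ha0 : ha.realBasis.repr (latticeVec a) 0 = 1 := by
    have := ha.repr_self 0 0
    simpa using this
  have hr : ∀ j i, ha.realBasis.repr (latticeVec (r j)) i = if Fin.succ j = i then 1 else 0 := by
    intro j i
    have := ha.repr_self (Fin.succ j) i
    simpa using this
  have hz0 : ha.realBasis.repr z 0 = 0 := by
    simp [hz, hr]
  have hzs : ∀ j, ha.realBasis.repr z (Fin.succ j) = 1 := by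
    intro j
    simp [hz, hr]
  have hzσ : z ∈ latticeCone (insert a (Set.range r)) :=
    Submodule.sum_mem _ fun j _ => latticeVec_mem_latticeCone (Or.inr ⟨j, rfl⟩)
  -- By finiteness one cone contains infinitely many points of a sequence tending to `z` from beyond
  -- the facet; being closed, it also contains `z`.
  obtain ⟨σ', hσ', hfreq⟩ := hΓ.exists_frequently_mem
    fun t : ℕ => z - (1 / ((t : ℝ) + 1)) • latticeVec a
  have hzσ' : z ∈ σ' := by
    refine (hsm σ' hσ').isClosed.mem_of_frequently_of_tendsto hfreq ?_
    have h1 : Filter.Tendsto (fun t : ℕ => z - (1 / ((t : ℝ) + 1)) • latticeVec a) Filter.atTop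
        (nhds (z - (0 : ℝ) • latticeVec a)) :=
      tendsto_const_nhds.sub (tendsto_one_div_add_atTop_nhds_zero_nat.smul_const _)
    simpa using h1
  obtain ⟨t, ht⟩ := hfreq.exists
  obtain ⟨ε, hε, hy⟩ : ∃ ε : ℝ, 0 < ε ∧ z - ε • latticeVec a ∈ σ' :=
    ⟨_, Nat.one_div_pos_of_nat, ht⟩
  have hy0 : ha.realBasis.repr (z - ε • latticeVec a) 0 = -ε := by
    simp [hz0, ha0]
  have hface := Γ.inter_isFaceOf _ hmem σ' hσ'
  have hrange : insert a (Set.range r) = Set.range (Fin.cons a r : Fin (k + 1) → Fin n → ℤ) :=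
    (Fin.range_cons a r).symm
  have hirr : ∀ j, r j ∈ latticeIrreducibles σ' := by
    intro j
    refine mem_latticeIrreducibles_of_mem hface.2 ?_ ?_
    · rw [hrange, ha.latticeIrreducibles_range]
      exact ⟨Fin.succ j, by simp⟩
    · have h1 := hface.1
      rw [hrange, ← Set.image_univ] at h1 hzσ
      have := ha.mem_of_repr_pos h1 hzσ hzσ' (i := Fin.succ j) (by rw [hzs]; exact one_pos)
      simpa using this
  obtain ⟨u, s, hu, rfl⟩ := hsm σ' hσ'
  rw [hu.latticeIrreducibles_image] at hirr
  choose f hfs hf using hirr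
  have hrinj : Function.Injective r := by
    have h1 := ha.1.injective.comp (Fin.succ_injective k)
    intro i j hij
    exact h1 (by simpa using hij)
  have hfinj : Function.Injective f := by
    intro i j hij
    apply hrinj
    rw [← hf i, ← hf j, hij]
  have hy' := (hu.mem_latticeCone_image s _).1 hy
  -- The `r j` alone span only the hyperplane where the `a`-coordinate vanishes, so a point beyond
  -- it needs another generator.
  obtain ⟨i₀, hi₀, hi₀'⟩ : ∃ i₀, i₀ ∉ Set.range f ∧
      hu.realBasis.repr (z - ε • latticeVec a) i₀ ≠ 0 := by
    by_contra! h
    have : ha.realBasis.repr (z - ε • latticeVec a) 0 = 0 := by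
      have hcoord : ∀ w, ha.realBasis.repr w 0 = ha.realBasis.coord 0 w := fun w => rfl
      rw [hcoord, hu.map_eq_sum]
      refine Finset.sum_eq_zero fun i _ => ?_
      by_cases hi : i ∈ Set.range f
      · obtain ⟨j, rfl⟩ := hi
        rw [hf j, ← hcoord, hr, if_neg (Fin.succ_ne_zero j), mul_zero]
      · rw [h i hi, zero_mul]
    rw [hy0] at this
    linarith
  have hi₀s : i₀ ∈ s := by
    by_contra h
    exact hi₀' ((hy' i₀).2 h)
  let F : Fin (k + 1) → Fin n := Fin.cons i₀ f
  have hFinj : Function.Injective F := Fin.cons_injective_iff.2 ⟨hi₀, hfinj⟩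
  have hFbij : Function.Bijective F :=
    (Fintype.bijective_iff_injective_and_card F).2 ⟨hFinj, by simp [hn]⟩
  let E : Fin (k + 1) ≃ Fin n := Equiv.ofBijective F hFbij
  have hcomp : u ∘ E = (Fin.cons (u i₀) r : Fin (k + 1) → Fin n → ℤ) := by
    funext j
    refine Fin.cases ?_ (fun j => ?_) j
    · simp [E, F]
    · simp [E, F, hf]
  have hb : IsLatticeBasis (Fin.cons (u i₀) r : Fin (k + 1) → (Fin n → ℤ)) :=
    hcomp ▸ hu.comp_equiv E
  have hs : s = Set.univ := by
    refine Set.eq_univ_of_forall fun i => ?_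
    obtain ⟨j, rfl⟩ := hFbij.2 i
    refine Fin.cases ?_ (fun j => ?_) j
    · simpa [F] using hi₀s
    · simpa [F] using hfs j
  have hrange' : u '' s = Set.range (Fin.cons (u i₀) r : Fin (k + 1) → Fin n → ℤ) := by
    rw [hs, Set.image_univ, ← hcomp, E.surjective.range_comp]
  set b := u i₀
  set q : ℤ := ha.intBasis.repr b 0 with hq
  have hqb : ha.realBasis.repr (latticeVec b) 0 = q := ha.repr_latticeVec b 0
  have hexp : ∀ w, ha.realBasis.repr w 0 = hb.realBasis.repr w 0 * q := by
    intro w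
    have hcoord : ∀ w, ha.realBasis.repr w 0 = ha.realBasis.coord 0 w := fun w => rfl
    rw [hcoord, hb.map_eq_sum, Fin.sum_univ_succ]
    simp only [Fin.cons_zero, Fin.cons_succ, ← hcoord, hr, hqb]
    simp
  have hqneg : q < 0 := by
    rw [hrange', hb.mem_latticeCone_range] at hy
    have h0 := hy 0
    have h1 := hexp (z - ε • latticeVec a)
    rw [hy0] at h1
    by_contra! hq0
    have : (0 : ℝ) ≤ q := by exact_mod_cast hq0
    have := mul_nonneg h0 this
    linarith
  -- Expanding `a` in the basis containing `b` shows that the integer `q` divides 1; its sign is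
  -- already known.
  have hqone : q = -1 := by
    have h1 := hexp (latticeVec a)
    rw [ha0, hb.repr_latticeVec] at h1
    have h2 : 1 = hb.intBasis.repr a 0 * q := by exact_mod_cast h1
    rcases Int.isUnit_iff.1 (IsUnit.of_mul_eq_one_right _ h2.symm) with h | h <;> omega
  have hint0 : ha.intBasis.repr a 0 = 1 := by
    have := ha0
    rw [ha.repr_latticeVec] at this
    exact_mod_cast this
  refine ⟨b, fun j => ha.intBasis.repr (a + b) (Fin.succ j), hb, ?_, ?_, ?_⟩
  · rw [← Fin.range_cons, ← hrange']
    exact hσ'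
  · intro hab
    rw [← hab, hint0] at hq
    omega
  · conv_lhs => rw [← ha.intBasis.sum_repr (a + b)]
    rw [Fin.sum_univ_succ]
    simp [← hq, hqone, hint0]

/-! ### The bend as a change of linear form -/

namespace WallRelation

variable {Φ : Fan n} (w : Φ.WallRelation)

lemma cone_a_mem_maxCones : latticeCone (insert w.a (Set.range w.r)) ∈ Φ.maxCones := by
  refine ⟨w.cone_a_mem, ?_⟩
  have := w.basis_a.coneDim_range
  rwa [Fin.range_cons] at this

lemma cone_b_mem_maxCones : latticeCone (insert w.b (Set.range w.r)) ∈ Φ.maxCones := by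
  refine ⟨w.cone_b_mem, ?_⟩
  have := w.basis_b.coneDim_range
  rwa [Fin.range_cons] at this

lemma latticeVec_relation :
    latticeVec w.a + latticeVec w.b = ∑ i, (w.c i : ℝ) • latticeVec (w.r i) := by
  have := congrArg latticeVec w.relation
  simpa only [latticeVec_add, latticeVec_sum, latticeVec_zsmul] using this

/-- Applying `m` to the wall relation turns the sum over the `r i` into `m a + m b`, so the bend is
the gap at `b` between `f` and the linear extension from the other side. -/
lemma bend_eq {f : (Fin n → ℝ) → ℝ} {m : (Fin n → ℝ) →ₗ[ℝ] ℝ}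
    (hm : ∀ x ∈ latticeCone (insert w.a (Set.range w.r)), f x = m x) :
    w.bend f = m (latticeVec w.b) - f (latticeVec w.b) := by
  have h := congrArg m w.latticeVec_relation
  simp only [map_add, map_sum, map_smul, smul_eq_mul] at h
  have hr : ∀ i, f (latticeVec (w.r i)) = m (latticeVec (w.r i)) := fun i =>
    hm _ (latticeVec_mem_latticeCone (Or.inr ⟨i, rfl⟩))
  have ha := hm _ (latticeVec_mem_latticeCone (Set.mem_insert w.a (Set.range w.r)))
  simp only [bend, hr, ha]
  linarith

lemma bend_add_mul (h g : (Fin n → ℝ) → ℝ) (ε : ℝ) :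
    w.bend (fun x => h x + ε * g x) = w.bend h + ε * w.bend g := by
  simp only [bend, mul_add, Finset.sum_add_distrib, mul_sub, Finset.mul_sum, mul_left_comm ε]
  ring

/-- The linear forms on the two sides of a wall differ by the bend. -/
lemma map_sub_map {f : (Fin n → ℝ) → ℝ} {m m' : (Fin n → ℝ) →ₗ[ℝ] ℝ}
    (hm : ∀ x ∈ latticeCone (insert w.a (Set.range w.r)), f x = m x)
    (hm' : ∀ x ∈ latticeCone (insert w.b (Set.range w.r)), f x = m' x) (x : Fin n → ℝ) :
    m' x - m x = w.basis_a.realBasis.repr x 0 * w.bend f := by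
  have hr : ∀ i, m' (latticeVec (w.r i)) - m (latticeVec (w.r i)) = 0 := fun i => by
    rw [← hm _ (latticeVec_mem_latticeCone (Or.inr ⟨i, rfl⟩)),
      ← hm' _ (latticeVec_mem_latticeCone (Or.inr ⟨i, rfl⟩)), sub_self]
  have h := congrArg (m' - m) w.latticeVec_relation
  simp only [map_add, map_sum, map_smul, smul_eq_mul, LinearMap.sub_apply, hr, mul_zero,
    Finset.sum_const_zero] at h
  have hb := w.bend_eq hm
  rw [hm' _ (latticeVec_mem_latticeCone (Set.mem_insert w.b (Set.range w.r)))] at hb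
  rw [← LinearMap.sub_apply, w.basis_a.map_eq_sum, Fin.sum_univ_succ]
  simp only [Fin.cons_zero, Fin.cons_succ, LinearMap.sub_apply, hr, mul_zero,
    Finset.sum_const_zero, add_zero]
  congr 1
  linarith

end WallRelation

/-! ### From positive bends to strict upper convexity -/

/-- A point outside the cone has a negative coordinate; the facet opposite that generator separates
the point from the cone. The basis is reordered to put this generator first. -/
lemma exists_wallRelation_of_notMem {Γ : Fan n} (hΓ : Γ.IsComplete) (hsm : Γ.IsSmooth)
    {σ : PointedCone ℝ (Fin n → ℝ)} (hσ : σ ∈ Γ.maxCones) {x : Fin n → ℝ} (hx : x ∉ σ) :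
    ∃ w : Γ.WallRelation, σ = latticeCone (insert w.a (Set.range w.r)) ∧
      w.basis_a.realBasis.repr x 0 < 0 := by
  obtain ⟨v, hv, rfl⟩ := (hsm σ hσ.1).exists_basis_of_coneDim hσ.2
  obtain ⟨i, hi⟩ : ∃ i, hv.realBasis.repr x i < 0 := by
    by_contra! h
    exact hx ((hv.mem_latticeCone_range x).2 h)
  obtain ⟨k, ⟨e⟩⟩ : ∃ k, Nonempty (Fin (k + 1) ≃ Fin n) := by
    cases n with
    | zero => exact i.elim0
    | succ k => exact ⟨k, ⟨Equiv.refl _⟩⟩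
  let e' : Fin (k + 1) ≃ Fin n := (Equiv.swap 0 (e.symm i)).trans e
  have he' : e' 0 = i := by simp [e']
  have hu : IsLatticeBasis (v ∘ e') := hv.comp_equiv e'
  have hneg : hu.realBasis.repr x 0 < 0 := by
    have hb : hu.realBasis = hv.realBasis.reindex e'.symm := by
      ext1 j
      simp
    rw [hb, Module.Basis.repr_reindex_apply, Equiv.symm_symm, he']
    exact hi
  have hrange : Set.range v = Set.range (v ∘ e') := (e'.surjective.range_comp v).symm
  obtain ⟨a, r, har⟩ : ∃ a r, v ∘ e' = (Fin.cons a r : Fin (k + 1) → Fin n → ℤ) :=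
    ⟨_, _, (Fin.cons_self_tail _).symm⟩
  rw [hrange] at hσ ⊢
  clear_value e'
  clear hrange
  revert hu hσ
  generalize v ∘ e' = u at har
  subst har
  intro hσ hu hneg
  rw [Fin.range_cons] at hσ ⊢
  obtain ⟨b, c, hb, hbm, hne, hrel⟩ := exists_adjacent_cone hΓ hsm hu hσ.1
  exact ⟨⟨k, r, a, b, c, hu, hb, hσ.1, hbm, hne, hrel⟩, rfl, hneg⟩

/-- A support function of a smooth complete fan that bends strictly across every wall is strictly
upper convex. -/
theorem isStrictlyUpperConvex_of_bend_pos {Γ : Fan n} (hΓ : Γ.IsComplete) (hsm : Γ.IsSmooth)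
    {f : (Fin n → ℝ) → ℝ} (hf : Γ.IsSupportFunction f)
    (hbend : ∀ w : Γ.WallRelation, 0 < w.bend f) : Γ.IsStrictlyUpperConvex f := by
  have hstep : ∀ σ ∈ Γ.maxCones, ∀ m : (Fin n → ℝ) →ₗ[ℝ] ℝ, (∀ y ∈ σ, f y = m y) →
      ∀ x, x ∉ σ → ∃ σ' ∈ Γ.maxCones, ∀ m' : (Fin n → ℝ) →ₗ[ℝ] ℝ, (∀ y ∈ σ', f y = m' y) →
        m' x < m x := by
    intro σ hσ m hm x hx
    obtain ⟨w, rfl, hneg⟩ := exists_wallRelation_of_notMem hΓ hsm hσ hx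
    refine ⟨_, w.cone_b_mem_maxCones, fun m' hm' => ?_⟩
    have := w.map_sub_map hm hm' x
    have := mul_neg_of_neg_of_pos hneg (hbend w)
    linarith
  choose! m hm using hf
  have hfin : Γ.maxCones.Finite := Γ.finite_cones.subset fun σ hσ => hσ.1
  -- By `hstep`, a form with least value at `x` cannot belong to a cone missing `x`.
  have hmin : ∀ x, ∃ σ ∈ Γ.maxCones, x ∈ σ ∧ ∀ σ' ∈ Γ.maxCones, m σ x ≤ m σ' x := by
    intro x
    obtain ⟨σ, hσ, hle⟩ := Set.exists_min_image Γ.maxCones (fun σ => m σ x) hfin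
      hΓ.maxCones_nonempty
    refine ⟨σ, hσ, ?_, hle⟩
    by_contra hx
    obtain ⟨σ', hσ', hlt⟩ := hstep σ hσ (m σ) (hm σ hσ) x hx
    exact (hlt _ (hm σ' hσ')).not_ge (hle σ' hσ')
  have hle : ∀ σ ∈ Γ.maxCones, ∀ x, f x ≤ m σ x := by
    intro σ hσ x
    obtain ⟨τ, hτ, hx, h⟩ := hmin x
    rw [hm τ hτ x hx]
    exact h σ hσ
  refine ⟨fun σ hσ => ⟨m σ, hm σ hσ⟩, ⟨convex_univ, fun x _ y _ s t hs ht _ => ?_⟩, ?_⟩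
  · obtain ⟨σ, hσ, hmem, -⟩ := hmin (s • x + t • y)
    rw [hm σ hσ _ hmem]
    simp only [map_add, map_smul, smul_eq_mul]
    gcongr
    · exact hle σ hσ x
    · exact hle σ hσ y
  · intro σ hσ m' hm' x hfx
    by_contra hx
    obtain ⟨σ', hσ', hlt⟩ := hstep σ hσ m' hm' x hx
    have h1 := hlt _ (hm σ' hσ')
    have h2 := hle σ' hσ' x
    linarith

/-! ### Finiteness of the set of walls -/

/-- The primitive ray generators of a smooth fan. -/
def rayGenerators (Φ : Fan n) : Set (Fin n → ℤ) :=
  ⋃ σ ∈ Φ.cones, latticeIrreducibles σ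

lemma finite_rayGenerators {Γ : Fan n} (hsm : Γ.IsSmooth) : Γ.rayGenerators.Finite :=
  Γ.finite_cones.biUnion fun σ hσ => (hsm σ hσ).finite_latticeIrreducibles

namespace WallRelation

variable {Φ : Fan n} (w : Φ.WallRelation)

lemma mem_latticeIrreducibles_a {p : Fin n → ℤ} (hp : p ∈ insert w.a (Set.range w.r)) :
    p ∈ latticeIrreducibles (latticeCone (insert w.a (Set.range w.r))) := by
  have := w.basis_a.latticeIrreducibles_range
  rw [Fin.range_cons] at this
  rwa [this]

lemma mem_latticeIrreducibles_b {p : Fin n → ℤ} (hp : p ∈ insert w.b (Set.range w.r)) :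
    p ∈ latticeIrreducibles (latticeCone (insert w.b (Set.range w.r))) := by
  have := w.basis_b.latticeIrreducibles_range
  rw [Fin.range_cons] at this
  rwa [this]

lemma a_mem_rayGenerators : w.a ∈ Φ.rayGenerators :=
  Set.mem_biUnion w.cone_a_mem (w.mem_latticeIrreducibles_a (Set.mem_insert _ _))

lemma b_mem_rayGenerators : w.b ∈ Φ.rayGenerators :=
  Set.mem_biUnion w.cone_b_mem (w.mem_latticeIrreducibles_b (Set.mem_insert _ _))

lemma r_mem_rayGenerators (i : Fin w.k) : w.r i ∈ Φ.rayGenerators :=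
  Set.mem_biUnion w.cone_a_mem (w.mem_latticeIrreducibles_a (Or.inr ⟨i, rfl⟩))

end WallRelation

/-- The generators range over a finite set, and linear independence of `r` makes them determine the
coefficients `c`. -/
lemma finite_wallRelation {Γ : Fan n} (hsm : Γ.IsSmooth) : Finite Γ.WallRelation := by
  have hfin : Finite Γ.rayGenerators := (finite_rayGenerators hsm).to_subtype
  have hk : ∀ w : Γ.WallRelation, w.k < n := fun w => by
    have := w.basis_a.card_eq
    simp only [Fintype.card_fin] at this
    omega
  let F : Γ.WallRelation →
      Σ k : Fin n, Γ.rayGenerators × Γ.rayGenerators × (Fin k → Γ.rayGenerators) := fun w =>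
    ⟨⟨w.k, hk w⟩, ⟨w.a, w.a_mem_rayGenerators⟩, ⟨w.b, w.b_mem_rayGenerators⟩,
      fun i => ⟨w.r i, w.r_mem_rayGenerators i⟩⟩
  refine Finite.of_injective F fun w w' h => ?_
  obtain ⟨k, r, a, b, c, ha, hb, hma, hmb, hne, hrel⟩ := w
  obtain ⟨k', r', a', b', c', ha', hb', hma', hmb', hne', hrel'⟩ := w'
  simp only [F, Sigma.mk.injEq, Fin.mk.injEq] at h
  obtain ⟨rfl, h⟩ := h
  simp only [heq_eq_eq, Prod.mk.injEq, Subtype.mk.injEq] at h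
  obtain ⟨rfl, rfl, h⟩ := h
  obtain rfl : r = r' := by
    funext i
    exact congrArg Subtype.val (congrFun h i)
  have hli : LinearIndependent ℤ r := by
    simpa [Function.comp_def] using ha.1.comp _ (Fin.succ_injective k)
  obtain rfl : c = c' := by
    have := Fintype.linearIndependent_iff.1 hli (c - c') (by
      simp only [Pi.sub_apply, sub_smul, Finset.sum_sub_distrib]
      rw [← hrel, ← hrel', sub_self])
    funext i
    exact sub_eq_zero.1 (this i)
  rfl

end Fan

/-! ### Concavity and relative interiors -/

/-- A linear form that represents a concave function on a full-dimensional smooth cone dominates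
it everywhere. -/
lemma ConcaveOn.le_linearForm {n : ℕ} {ι : Type} [Fintype ι] {h : (Fin n → ℝ) → ℝ}
    (hh : ConcaveOn ℝ Set.univ h) {v : ι → Fin n → ℤ} (hv : IsLatticeBasis v)
    {m : (Fin n → ℝ) →ₗ[ℝ] ℝ} (hm : ∀ x ∈ latticeCone (Set.range v), h x = m x)
    (x : Fin n → ℝ) : h x ≤ m x := by
  classical
  -- Replacing coordinates by absolute values puts both `y` and the midpoint of `x` and `y` in the
  -- cone, where `h` is `m`; concavity at the midpoint then bounds `h x`.
  let y : Fin n → ℝ := ∑ i, |hv.realBasis.repr x i| • latticeVec (v i)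
  have hy : ∀ i, hv.realBasis.repr y i = |hv.realBasis.repr x i| := by
    intro i
    simp [y, hv.repr_self, Finsupp.finsetSum_apply]
  have hyσ : y ∈ latticeCone (Set.range v) := by
    rw [hv.mem_latticeCone_range]
    intro i
    rw [hy]
    exact abs_nonneg _
  have hmid : (1 / 2 : ℝ) • x + (1 / 2 : ℝ) • y ∈ latticeCone (Set.range v) := by
    rw [hv.mem_latticeCone_range]
    intro i
    simp only [map_add, map_smul, Finsupp.add_apply, Finsupp.smul_apply, hy, smul_eq_mul]
    have := neg_abs_le (hv.realBasis.repr x i)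
    linarith
  have h1 := hh.2 (Set.mem_univ x) (Set.mem_univ y) (by norm_num : (0 : ℝ) ≤ 1 / 2)
    (by norm_num : (0 : ℝ) ≤ 1 / 2) (by norm_num)
  rw [hm _ hmid, hm _ hyσ] at h1
  simp only [map_add, map_smul, smul_eq_mul] at h1
  linarith

/-- The line through `z` and `z + s` stays in the affine span, so it can be followed slightly
backwards from `z` without leaving the cone. -/
lemma PointedCone.exists_sub_smul_mem_of_mem_intrinsicInterior {n : ℕ}
    {τ : PointedCone ℝ (Fin n → ℝ)} {z s : Fin n → ℝ}
    (hz : z ∈ intrinsicInterior ℝ (τ : Set (Fin n → ℝ))) (hs : s ∈ τ) :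
    ∃ ε : ℝ, 0 < ε ∧ z - ε • s ∈ τ := by
  obtain ⟨y, hy, rfl⟩ := mem_intrinsicInterior.1 hz
  have hzτ : (y : Fin n → ℝ) ∈ τ := intrinsicInterior_subset hz
  have hzs : (y : Fin n → ℝ) + s ∈ affineSpan ℝ (τ : Set (Fin n → ℝ)) :=
    subset_affineSpan _ _ (Submodule.add_mem _ hzτ hs)
  let φ : ℝ → affineSpan ℝ (τ : Set (Fin n → ℝ)) := fun t =>
    ⟨AffineMap.lineMap (y : Fin n → ℝ) (y + s) t, AffineMap.lineMap_mem t y.2 hzs⟩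
  have hφ : Continuous φ := Continuous.subtype_mk AffineMap.lineMap_continuous _
  have hφ0 : φ 0 = y := Subtype.ext (AffineMap.lineMap_apply_zero _ _)
  have hev : ∀ᶠ t in nhds (0 : ℝ), φ t ∈ Subtype.val ⁻¹' (τ : Set (Fin n → ℝ)) := by
    refine hφ.continuousAt.eventually ?_
    rw [hφ0]
    exact mem_interior_iff_mem_nhds.1 hy
  have hev' := hev.filter_mono (nhdsWithin_le_nhds (s := Set.Iio 0))
  obtain ⟨t, ht, ht0⟩ := (hev'.and self_mem_nhdsWithin).exists
  refine ⟨-t, neg_pos.2 ht0, ?_⟩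
  have : (AffineMap.lineMap (y : Fin n → ℝ) (y + s) t : Fin n → ℝ) = y - (-t) • s := by
    simp [AffineMap.lineMap_apply, add_comm]
  rw [← this]
  exact ht

namespace Fan

variable {n : ℕ}

/-- A cone containing a full-dimensional cone is itself full-dimensional. -/
lemma Refines.exists_maxCones {Γ Φ : Fan n} (h : Γ.Refines Φ) {γ : PointedCone ℝ (Fin n → ℝ)}
    (hγ : γ ∈ Γ.maxCones) : ∃ σ ∈ Φ.maxCones, γ ≤ σ := by
  obtain ⟨σ, hσ, hle⟩ := h γ hγ.1
  refine ⟨σ, ⟨hσ, le_antisymm ?_ ?_⟩, hle⟩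
  · simpa [coneDim] using Submodule.finrank_le (Submodule.span ℝ (σ : Set (Fin n → ℝ)))
  · conv_lhs => rw [← hγ.2]
    exact Submodule.finrank_mono (Submodule.span_mono hle)

lemma IsSupportFunction.of_refines {Γ Φ : Fan n} (h : Γ.Refines Φ) {f : (Fin n → ℝ) → ℝ}
    (hf : Φ.IsSupportFunction f) : Γ.IsSupportFunction f := by
  intro γ hγ
  obtain ⟨σ, hσ, hle⟩ := h.exists_maxCones hγ
  obtain ⟨m, hm⟩ := hf σ hσ
  exact ⟨m, fun x hx => hm x (hle hx)⟩

lemma IsSupportFunction.add_mul {Φ : Fan n} {h g : (Fin n → ℝ) → ℝ}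
    (hh : Φ.IsSupportFunction h) (hg : Φ.IsSupportFunction g) (ε : ℝ) :
    Φ.IsSupportFunction fun x => h x + ε * g x := by
  intro σ hσ
  obtain ⟨m, hm⟩ := hh σ hσ
  obtain ⟨m', hm'⟩ := hg σ hσ
  exact ⟨m + ε • m', fun x hx => by simp [hm x hx, hm' x hx]⟩

namespace WallRelation

variable {Φ : Fan n} (w : Φ.WallRelation)

lemma repr_of_mem_intrinsicInterior {z : Fin n → ℝ}
    (hz : z ∈ intrinsicInterior ℝ (w.wall : Set (Fin n → ℝ))) :
    w.basis_a.realBasis.repr z 0 = 0 ∧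
      ∀ i : Fin w.k, 0 < w.basis_a.realBasis.repr z (Fin.succ i) := by
  have hwall : w.wall =
      latticeCone ((Fin.cons w.a w.r : Fin (w.k + 1) → Fin n → ℤ) '' Set.range Fin.succ) := by
    rw [wall, ← Set.range_comp]
    rfl
  refine ⟨?_, fun i => ?_⟩
  · have hzτ : z ∈ w.wall := intrinsicInterior_subset hz
    rw [hwall, w.basis_a.mem_latticeCone_image] at hzτ
    exact (hzτ 0).2 (by simp)
  · obtain ⟨ε, hε, hmem⟩ := PointedCone.exists_sub_smul_mem_of_mem_intrinsicInterior hz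
      (latticeVec_mem_latticeCone (Set.mem_range_self i))
    rw [hwall, w.basis_a.mem_latticeCone_image] at hmem
    have h1 := (hmem (Fin.succ i)).1
    have h2 := w.basis_a.repr_self (Fin.succ i) (Fin.succ i)
    rw [Fin.cons_succ, if_pos rfl] at h2
    simp only [map_sub, map_smul, Finsupp.sub_apply, Finsupp.smul_apply, h2, smul_eq_mul] at h1
    linarith

/-- A cone that contains both maximal cones at a wall contains the relative interior of the wall
in its interior. -/
lemma intrinsicInterior_subset_interior {σ : PointedCone ℝ (Fin n → ℝ)}
    (ha : latticeVec w.a ∈ σ) (hb : latticeVec w.b ∈ σ) (hr : ∀ i, latticeVec (w.r i) ∈ σ) :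
    intrinsicInterior ℝ (w.wall : Set (Fin n → ℝ)) ⊆ interior (σ : Set (Fin n → ℝ)) := by
  intro z hz
  obtain ⟨hz0, hzpos⟩ := w.repr_of_mem_intrinsicInterior hz
  have hcont : ∀ i, Continuous fun x => w.basis_a.realBasis.repr x i := fun i =>
    (w.basis_a.realBasis.coord i).continuous_of_finiteDimensional
  -- The second inequality is positivity of the `r i`-coordinate after `a` is replaced by `∑ c i • r
  -- i - b`, as needed on the side of `b`.
  let U : Set (Fin n → ℝ) := {x | ∀ i : Fin w.k, 0 < w.basis_a.realBasis.repr x (Fin.succ i) ∧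
    0 < w.basis_a.realBasis.repr x (Fin.succ i) + w.basis_a.realBasis.repr x 0 * w.c i}
  have hU : IsOpen U := by
    simp only [U, Set.ofPred_forall, Set.ofPred_and]
    exact isOpen_iInter_of_finite fun i =>
      (isOpen_lt continuous_const (hcont _)).inter
        (isOpen_lt continuous_const ((hcont _).add ((hcont 0).mul continuous_const)))
  refine mem_interior.2 ⟨U, fun x hx => ?_, hU, fun i => ⟨hzpos i, by
    simpa [hz0] using hzpos i⟩⟩
  have hsum := w.basis_a.sum_repr x
  rw [Fin.sum_univ_succ] at hsum
  simp only [Fin.cons_zero, Fin.cons_succ] at hsum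
  rcases le_total 0 (w.basis_a.realBasis.repr x 0) with h0 | h0
  · rw [← hsum]
    exact Submodule.add_mem _ (PointedCone.smul_mem _ h0 ha)
      (Submodule.sum_mem _ fun i _ => PointedCone.smul_mem _ (hx i).1.le (hr i))
  · have hx' : x = (-w.basis_a.realBasis.repr x 0) • latticeVec w.b +
        ∑ i, (w.basis_a.realBasis.repr x (Fin.succ i) + w.basis_a.realBasis.repr x 0 * w.c i) •
          latticeVec (w.r i) := by
      conv_lhs => rw [← hsum]
      simp only [add_smul, Finset.sum_add_distrib, mul_smul, ← Finset.smul_sum,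
        ← w.latticeVec_relation]
      module
    rw [hx']
    exact Submodule.add_mem _ (PointedCone.smul_mem _ (neg_nonneg.2 h0) hb)
      (Submodule.sum_mem _ fun i _ => PointedCone.smul_mem _ (hx i).2.le (hr i))

end WallRelation

/-! ### The sandwich argument -/

/-- The pullback of a strictly upper convex support function is upper convex, and it bends strictly
across every wall that is not interior to a maximal cone. -/
lemma IsStrictlyUpperConvex.bend_pos_or {Γ Φ : Fan n} (hΓΦ : Γ.Refines Φ)
    {h : (Fin n → ℝ) → ℝ} (hh : Φ.IsStrictlyUpperConvex h) (w : Γ.WallRelation) :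
    0 < w.bend h ∨ (w.bend h = 0 ∧ ∃ σ ∈ Φ.maxCones,
      intrinsicInterior ℝ (w.wall : Set (Fin n → ℝ)) ⊆ interior (σ : Set (Fin n → ℝ))) := by
  obtain ⟨hsupp, hconc, hstrict⟩ := hh
  obtain ⟨σ, hσ, hle⟩ := hΓΦ.exists_maxCones w.cone_a_mem_maxCones
  obtain ⟨m, hm⟩ := hsupp σ hσ
  have hma : ∀ x ∈ latticeCone (insert w.a (Set.range w.r)), h x = m x :=
    fun x hx => hm x (hle hx)
  have hbend := w.bend_eq hma
  have hbound : h (latticeVec w.b) ≤ m (latticeVec w.b) :=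
    hconc.le_linearForm w.basis_a (by rwa [Fin.range_cons]) _
  rcases hbound.lt_or_eq with hlt | heq
  · left
    linarith
  -- Equality at `b` puts `b` in `σ` by strictness, so `σ` contains both cones at the wall.
  · refine Or.inr ⟨by linarith, σ, hσ, w.intrinsicInterior_subset_interior
      (hle (latticeVec_mem_latticeCone (Set.mem_insert _ _))) (hstrict σ hσ m hm _ heq)
      fun i => hle (latticeVec_mem_latticeCone (Or.inr ⟨i, rfl⟩))⟩

/-- Small multiples of a relatively strictly convex function can be added to a strictly upper
convex function of an intermediate fan. -/
theorem exists_forall_add_mul_isStrictlyUpperConvex {S A Γ : Fan n} (hAS : A.Refines S)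
    (hΓ : Γ.IsComplete) (hsm : Γ.IsSmooth) (hΓA : Γ.Refines A) {h g : (Fin n → ℝ) → ℝ}
    (hh : A.IsStrictlyUpperConvex h) (hg : Γ.IsStrictlyConvexRelativeTo S g) :
    ∃ ε₀ : ℝ, 0 < ε₀ ∧ ∀ ε : ℝ, 0 < ε → ε < ε₀ →
      Γ.IsStrictlyUpperConvex (fun x => h x + ε * g x) := by
  have := finite_wallRelation hsm
  have hev : ∀ᶠ ε in nhdsWithin (0 : ℝ) (Set.Ioi 0), ∀ w : Γ.WallRelation,
      0 < w.bend h + ε * w.bend g := by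
    refine Filter.eventually_all.2 fun w => ?_
    rcases hh.bend_pos_or hΓA w with hpos | ⟨hzero, α, hα, hsub⟩
    · have hcont : Continuous fun ε : ℝ => w.bend h + ε * w.bend g := by fun_prop
      refine Filter.Eventually.filter_mono nhdsWithin_le_nhds
        (hcont.continuousAt.eventually_const_lt ?_)
      simpa using hpos
    · obtain ⟨σ, hσ, hle⟩ := hAS.exists_maxCones hα
      have hgpos := hg.2 w ⟨σ, hσ, hsub.trans (interior_mono hle)⟩
      filter_upwards [self_mem_nhdsWithin] with ε hε
      rw [hzero, zero_add]
      exact mul_pos hε hgpos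
  obtain ⟨ε₀, hε₀, hsub⟩ := mem_nhdsGT_iff_exists_Ioo_subset.1 hev
  refine ⟨ε₀, hε₀, fun ε h0 hlt => isStrictlyUpperConvex_of_bend_pos hΓ hsm
    ((hh.1.of_refines hΓA).add_mul hg.1 ε) fun w => ?_⟩
  rw [w.bend_add_mul]
  exact hsub ⟨h0, hlt⟩ w

/-! ### Integral support functions -/

/-- Integers on the ray generators of a smooth complete fan extend to a support function that is
integral on the lattice. -/
lemma exists_isSupportFunction_of_int {Γ : Fan n} (hΓ : Γ.IsComplete) (hsm : Γ.IsSmooth)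
    (φ : (Fin n → ℤ) → ℤ) :
    ∃ f : (Fin n → ℝ) → ℝ, Γ.IsSupportFunction f ∧
      (∀ v : Fin n → ℤ, ∃ z : ℤ, f (latticeVec v) = z) ∧
      ∀ p ∈ Γ.rayGenerators, f (latticeVec p) = φ p := by
  have hlin : ∀ σ ∈ Γ.cones, ∃ m : (Fin n → ℝ) →ₗ[ℝ] ℝ,
      (∀ v : Fin n → ℤ, ∃ z : ℤ, m (latticeVec v) = z) ∧
      ∀ p ∈ latticeIrreducibles σ, m (latticeVec p) = φ p := by
    intro σ hσ
    obtain ⟨v, s, hv, rfl⟩ := hsm σ hσ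
    have happ : ∀ i, hv.realBasis.constr ℝ (fun i => (φ (v i) : ℝ)) (latticeVec (v i)) =
        φ (v i) := fun i => by
      rw [← hv.realBasis_apply, Module.Basis.constr_basis]
    refine ⟨hv.realBasis.constr ℝ fun i => (φ (v i) : ℝ), fun u =>
      ⟨∑ i, hv.intBasis.repr u i * φ (v i), ?_⟩, ?_⟩
    · rw [hv.map_eq_sum]
      simp [happ, hv.repr_latticeVec]
    · rw [hv.latticeIrreducibles_image]
      rintro _ ⟨i, -, rfl⟩
      exact happ i
  choose! m hint hm using hlin
  choose C hC hxC using hΓ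
  -- A common point is a positive combination of generators of `σ` that also generate `τ`, and both
  -- forms equal `φ` on these.
  have hglue : ∀ σ ∈ Γ.cones, ∀ τ ∈ Γ.cones, ∀ x ∈ σ, x ∈ τ → m σ x = m τ x := by
    intro σ hσ τ hτ x hxσ hxτ
    obtain ⟨hface, hface'⟩ := Γ.inter_isFaceOf σ hσ τ hτ
    have hirr : ∀ p ∈ latticeIrreducibles σ, latticeVec p ∈ τ → m σ (latticeVec p) =
        m τ (latticeVec p) := fun p hp hpτ => by
      rw [hm σ hσ p hp, hm τ hτ p (mem_latticeIrreducibles_of_mem hface' hp hpτ)]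
    generalize m σ = mσ at hirr ⊢
    obtain ⟨v, s, hv, rfl⟩ := hsm σ hσ
    rw [hv.map_eq_sum, hv.map_eq_sum (m τ)]
    refine Finset.sum_congr rfl fun i _ => ?_
    have hi := (hv.mem_latticeCone_image s x).1 hxσ i
    rcases hi.1.lt_or_eq with hpos | hzero
    · rw [hirr (v i) ?_ (hv.mem_of_repr_pos hface hxσ hxτ hpos)]
      rw [hv.latticeIrreducibles_image]
      refine Set.mem_image_of_mem _ ?_
      by_contra his
      exact hpos.ne' (hi.2 his)
    · rw [← hzero, zero_mul, zero_mul]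
  refine ⟨fun x => m (C x) x, fun σ hσ => ⟨m σ, fun x hx => ?_⟩, fun v => hint _ (hC _) v, ?_⟩
  · exact hglue _ (hC x) σ hσ.1 x (hxC x) hx
  · intro p hp
    obtain ⟨σ, hσ, hpσ⟩ := Set.mem_iUnion₂.1 hp
    exact (hglue _ (hC _) σ hσ _ (hxC _) hpσ.1).trans (hm σ hσ p hpσ)

/-- Zero bend would put `b` in the cone `⟨τ, a⟩` by strictness, but the wall relation gives `b` the
`a`-coordinate `-1`. -/
lemma IsStrictlyUpperConvex.bend_pos {Γ : Fan n} {f : (Fin n → ℝ) → ℝ}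
    (hf : Γ.IsStrictlyUpperConvex f) (w : Γ.WallRelation) : 0 < w.bend f := by
  obtain ⟨hsupp, hconc, hstrict⟩ := hf
  obtain ⟨m, hm⟩ := hsupp _ w.cone_a_mem_maxCones
  have hbound : f (latticeVec w.b) ≤ m (latticeVec w.b) :=
    hconc.le_linearForm w.basis_a (by rwa [Fin.range_cons]) _
  rw [w.bend_eq hm, sub_pos]
  refine hbound.lt_of_ne fun heq => ?_
  have hb := hstrict _ w.cone_a_mem_maxCones m hm _ heq
  rw [← Fin.range_cons, w.basis_a.mem_latticeCone_range] at hb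
  have hrel := congrArg (fun x => w.basis_a.realBasis.repr x 0) w.latticeVec_relation
  have ha := w.basis_a.repr_self 0 0
  have hr : ∀ i, w.basis_a.realBasis.repr (latticeVec (w.r i)) 0 = 0 := fun i => by
    have := w.basis_a.repr_self (Fin.succ i) 0
    rwa [Fin.cons_succ, if_neg (Fin.succ_ne_zero i)] at this
  rw [Fin.cons_zero, if_pos rfl] at ha
  simp only [map_add, map_sum, map_smul, Finsupp.add_apply, Finsupp.finsetSum_apply,
    Finsupp.smul_apply, hr, ha, smul_zero, Finset.sum_const_zero] at hrel
  have := hb 0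
  linarith

/-- Rounding a large multiple of a strictly upper convex support function on the ray generators
gives one that is integral on the lattice. -/
theorem IsProjective.exists_int {Γ : Fan n} (hΓ : Γ.IsComplete) (hsm : Γ.IsSmooth)
    (hproj : Γ.IsProjective) :
    ∃ f : (Fin n → ℝ) → ℝ, Γ.IsStrictlyUpperConvex f ∧
      ∀ v : Fin n → ℤ, ∃ z : ℤ, f (latticeVec v) = z := by
  obtain ⟨f, hf⟩ := hproj
  have := finite_wallRelation hsm
  -- Rounding down at `a` and `b` can only increase the bend; at each `r i` it costs at most `|c
  -- i|`.
  have hev : ∀ᶠ N : ℝ in Filter.atTop, ∀ w : Γ.WallRelation,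
      ∑ i, |(w.c i : ℝ)| < N * w.bend f :=
    Filter.eventually_all.2 fun w =>
      (Filter.tendsto_id.atTop_mul_const (hf.bend_pos w)).eventually_gt_atTop _
  obtain ⟨N, hN⟩ := hev.exists
  obtain ⟨F, hF, hFint, hFφ⟩ := exists_isSupportFunction_of_int hΓ hsm
    fun p => ⌊N * f (latticeVec p)⌋
  refine ⟨F, isStrictlyUpperConvex_of_bend_pos hΓ hsm hF fun w => ?_, hFint⟩
  have ha : F (latticeVec w.a) ≤ N * f (latticeVec w.a) := by
    rw [hFφ _ w.a_mem_rayGenerators]; exact Int.floor_le _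
  have hb : F (latticeVec w.b) ≤ N * f (latticeVec w.b) := by
    rw [hFφ _ w.b_mem_rayGenerators]; exact Int.floor_le _
  have hr : ∀ i, (w.c i : ℝ) * (N * f (latticeVec (w.r i))) - |(w.c i : ℝ)| ≤
      w.c i * F (latticeVec (w.r i)) := by
    intro i
    rw [hFφ _ (w.r_mem_rayGenerators i)]
    have h1 : |N * f (latticeVec (w.r i)) - ⌊N * f (latticeVec (w.r i))⌋| ≤ 1 := by
      rw [Int.self_sub_floor, Int.abs_fract]
      exact (Int.fract_lt_one _).le
    have h2 := le_abs_self ((w.c i : ℝ) *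
      (N * f (latticeVec (w.r i)) - ⌊N * f (latticeVec (w.r i))⌋))
    rw [abs_mul] at h2
    have h3 := mul_le_mul_of_nonneg_left h1 (abs_nonneg (w.c i : ℝ))
    linarith
  have hsum := Finset.sum_le_sum fun i (_ : i ∈ Finset.univ) => hr i
  rw [Finset.sum_sub_distrib] at hsum
  have hlt := hN w
  have hmul : N * w.bend f = ∑ i, (w.c i : ℝ) * (N * f (latticeVec (w.r i))) -
      N * f (latticeVec w.a) - N * f (latticeVec w.b) := by
    simp only [WallRelation.bend, mul_sub, Finset.mul_sum, mul_left_comm N]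
  rw [WallRelation.bend]
  linarith

end Fan

theorem lemma6p4 {n : ℕ} (S A Γ : Fan n)
    (hS : S.IsComplete)
    (hA : A.IsComplete) (hAproj : A.IsProjective) (hAS : A.Refines S)
    (hΓ : Γ.IsComplete) (hΓsmooth : Γ.IsSmooth) (hΓA : Γ.Refines A)
    (hΓS : Γ.IsProjectiveOver S) :
    Γ.IsProjective ∧
    (∃ f : (Fin n → ℝ) → ℝ, Γ.IsStrictlyUpperConvex f ∧
      ∀ v : Fin n → ℤ, ∃ z : ℤ, f (latticeVec v) = z) ∧
    ∀ h g : (Fin n → ℝ) → ℝ,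
      A.IsStrictlyUpperConvex h → Γ.IsStrictlyConvexRelativeTo S g →
      ∃ ε₀ : ℝ, 0 < ε₀ ∧ ∀ ε : ℝ, 0 < ε → ε < ε₀ →
        Γ.IsStrictlyUpperConvex (fun x => h x + ε * g x) := by
  have key := fun (h g : (Fin n → ℝ) → ℝ) hh hg =>
    Fan.exists_forall_add_mul_isStrictlyUpperConvex (h := h) (g := g) hAS hΓ hΓsmooth hΓA hh hg
  have hproj : Γ.IsProjective := by
    obtain ⟨h, hh⟩ := hAproj
    obtain ⟨g, hg⟩ := hΓS
    obtain ⟨ε₀, hε₀, hε⟩ := key h g hh hg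
    exact ⟨_, hε (ε₀ / 2) (half_pos hε₀) (half_lt_self hε₀)⟩
  exact ⟨hproj, hproj.exists_int hΓ hΓsmooth, key⟩
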